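/- Theorem 2. Consider a power system with a fixed stock of generation technologies $i$. Technology $i$ can run at any rate $q$ in an interval $R_i$ at a convex cost $C_i(q)$ per hour (a generator of capacity $k_i$ and constant variable cost $c_i$ has $R_i=[0,k_i]$, $C_i(q)=c_iq$; load shedding and the spilling of surplus energy count as technologies). The dispatch cost of a net load $n$ is $DC(n)=\min\{\sum_i C_i(Q_i):\sum_i Q_i=n,\ Q_i\in R_i\}$, and it is assumed that this is finite for every $n\in\mathbb R$. Let $\Delta>0$ be the length of a dispatch interval in hours and $\delta\in[0,1)$ the discount factor per interval. The loads $L$ of successive intervals are independent and identically distributed, with values in a bounded interval. A lossless, not rate-limited storage of volume $K\ge 0$ has closing states of charge in $[S^{\min},S^{\max}]$, $S^{\max}=S^{\min}+K$. For every opening state of charge $S\in\mathbb R$ let $$V(S\mid K)=\min_{S^+_{SL}\in[S^{\min},S^{\max}]}E_L\Bigl[DC\bigl(L-(S-S^+_{SL})/\Delta\bigr)+\delta V(S^+_{SL}\mid K)\Bigr],$$ where $V(\cdot\mid K)$ is the (measurable) solution bounded on $[S^{\min},S^{\max}]$. The total cost in state $S$ is $V(S\mid K)+\frac{F}{1-\delta}+\frac{f_SK}{1-\delta}$,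 where $F$ is the hourly fixed cost of the generation stock and $f_S$ the fixed cost of storage per unit of volume and per hour. Let $K>0$, let $S^+_{SL}$ be an optimal policy for $K$, and suppose that for each $S\in[S^{\min},S^{\max}]$ the dispatch cost is, for almost every load, differentiable at the net load that occurs under this policy. Let $P_{SL}=DC'(L-(S-S^+_{SL})/\Delta)$ be the spot price, $E[P^+_{SL}]=E_{L'}[P_{S^+_{SL}L'}]$ the expected price in the next interval, and $x$ a stationary distribution on $[S^{\min},S^{\max}]$ of the state of charge under the policy. Call $K$ optimal if it minimizes, over all volumes $K'\ge 0$, the total cost with volume $K'$ averaged over $S\sim x$, with $x$ held fixed (the planner does not know the state of charge at the time of investment). Then $K$ is optimal if and only if the area below $\delta E[P^+_{SL}]$ and above the price-duration curve (prices drawn against the duration of the load, for given $S$), averaged over $S\sim x$, equals $\Delta f_S$. Equivalently, $K$ is optimal if and only if, with $S\sim x$ and $L$ independent of $S$, $$E_{SL}\bigl[(\delta E[P^+_{SL}]-P_{SL})\,1(\delta E[P^+_{SL}]\ge P_{SL})\bigr]=\Delta f_S .$$ In particular, when the dispatch interval is the unit of time ($\Delta=1$), the right-hand side is the fixed cost of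 storage $f_S$. -/

import Mathlib

open MeasureTheory Set

/-- A power system with a fixed stock of generation, an i.i.d. load, and room for storage which is
perfectly efficient and not limited in the rate at which it charges or discharges.
A technology `i` runs at any rate `q ∈ range i` at cost `runCost i q` per hour. A generator with
capacity `k` and constant variable cost `c` has `range i = Icc 0 k` and `runCost i q = c * q`;
involuntary load shedding at the value of lost load `v` has `range i = Ici 0`, `runCost i q = v * q`;
spilling of surplus energy has `range i = Iic 0`, `runCost i q = 0`. -/
structure PowerSystem (ι : Type*) [Fintype ι] where
  /-- feasible rates of production of each technology (MW) -/
  range : ι → Set ℝ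
  /-- cost of running a technology at a given rate ($/h) -/
  runCost : ι → ℝ → ℝ
  convexOn_runCost : ∀ i, ConvexOn ℝ (range i) (runCost i)
  /-- fixed cost of the stock of generation ($/h) -/
  genFixedCost : ℝ
  /-- the common law of the independent draws of the load (MW) -/
  load : Measure ℝ
  isProbabilityMeasure_load : IsProbabilityMeasure load
  /-- lower bound on the load -/
  Lmin : ℝ
  /-- upper bound on the load -/
  Lmax : ℝ
  load_mem : ∀ᵐ l ∂load, l ∈ Icc Lmin Lmax
  /-- length of a dispatch interval (h) -/
  Δ : ℝ
  Δ_pos : 0 < Δ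
  /-- discount factor per dispatch interval -/
  δ : ℝ
  δ_nonneg : 0 ≤ δ
  δ_lt_one : δ < 1
  /-- minimum state of charge (MWh) -/
  Smin : ℝ
  /-- fixed cost of storage, per unit of storage volume and per hour -/
  fS : ℝ

namespace PowerSystem

variable {ι : Type*} [Fintype ι] (G : PowerSystem ι)

/-- The costs of all the feasible dispatches of the generation stock that serve the net load `n`. -/
def dispatchCosts (n : ℝ) : Set ℝ :=
  {c | ∃ Q : ι → ℝ, ∑ i, Q i = n ∧ (∀ i, Q i ∈ G.range i) ∧ c = ∑ i, G.runCost i (Q i)}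

/-- Every net load can be served, at a minimal cost that is not `-∞`. -/
def Servable : Prop :=
  ∀ n, (G.dispatchCosts n).Nonempty ∧ BddBelow (G.dispatchCosts n)

/-- The dispatch cost `DC`: the minimal cost (per hour) of serving the net load `n`. -/
noncomputable def dispatchCost (n : ℝ) : ℝ := sInf (G.dispatchCosts n)

/-- The possible closing states of charge `[Smin, Smax]`, `Smax = Smin + K`, of a storage system of
volume `K`. -/
def charges (K : ℝ) : Set ℝ := Icc G.Smin (G.Smin + K)

/-- Net load when the load is `l` and the state of charge goes from `S` to `s` in the interval. -/
noncomputable def netLoad (S l s : ℝ) : ℝ := l - (S - s) / G.Δ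

/-- Expected discounted cost of closing at `s l` when the load is `l`, starting from `S`, when the
cost to go from the next interval on is `W`. -/
noncomputable def expectedCost (W : ℝ → ℝ) (S : ℝ) (s : ℝ → ℝ) : ℝ :=
  ∫ l, (G.dispatchCost (G.netLoad S l (s l)) + G.δ * W (s l)) ∂G.load

/-- `V K S` is the minimal expected discounted dispatch cost with storage volume `K` and opening
state of charge `S`: the solution of the Bellman equation, measurable in `S` and bounded on the
closing states of charge. The opening state of charge is not restricted: only the closing ones are.
So `V K S` also makes sense when the storage opens with more charge than the volume `K` holds (the
excess then leaves the storage in the first interval). -/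
def IsValueFunction (V : ℝ → ℝ → ℝ) : Prop :=
  ∀ K, 0 ≤ K → Measurable (V K) ∧ BddBelow (V K '' G.charges K) ∧ BddAbove (V K '' G.charges K) ∧
    ∀ S, IsLeast {v | ∃ s : ℝ → ℝ, Measurable s ∧ (∀ l, s l ∈ G.charges K) ∧
      v = G.expectedCost (V K) S s} (V K S)

/-- `σ S l` is an optimal closing state of charge, for storage volume `K`, given the opening state
of charge `S` and the load `l`: it attains the minimum in the Bellman equation. -/
def IsOptimalPolicy (V : ℝ → ℝ → ℝ) (K : ℝ) (σ : ℝ → ℝ → ℝ) : Prop :=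
  Measurable (Function.uncurry σ) ∧
    ∀ S ∈ G.charges K, (∀ l, σ S l ∈ G.charges K) ∧ V K S = G.expectedCost (V K) S (σ S)

/-- The dispatch cost has a slope at the net loads that occur under the policy `σ`. -/
def HasPrices (K : ℝ) (σ : ℝ → ℝ → ℝ) : Prop :=
  ∀ S ∈ G.charges K, ∀ᵐ l ∂G.load, DifferentiableAt ℝ G.dispatchCost (G.netLoad S l (σ S l))

/-- The spot price `P_{SL}`: the slope of the dispatch cost at the net load. -/
noncomputable def price (σ : ℝ → ℝ → ℝ) (S l : ℝ) : ℝ :=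
  deriv G.dispatchCost (G.netLoad S l (σ S l))

/-- The expected price `E[P⁺_{SL}]` in the next interval. -/
noncomputable def nextPrice (σ : ℝ → ℝ → ℝ) (S l : ℝ) : ℝ :=
  ∫ l', G.price σ (σ S l) l' ∂G.load

/-- The probability of a transition from the state of charge `S` into the set `A`. -/
noncomputable def transition (σ : ℝ → ℝ → ℝ) (S : ℝ) (A : Set ℝ) : ENNReal :=
  G.load {l | σ S l ∈ A}

/-- `x` is a stationary distribution of the state of charge under the policy `σ`. -/
def IsStationary (K : ℝ) (σ : ℝ → ℝ → ℝ) (x : Measure ℝ) : Prop :=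
  IsProbabilityMeasure x ∧ (∀ᵐ S ∂x, S ∈ G.charges K) ∧
    ∀ A, MeasurableSet A → ∫⁻ S, G.transition σ S A ∂x = x A

/-- Total cost of the power system with storage volume `K` in the state `S`: discounted dispatch
cost and fixed costs of generation and storage. -/
noncomputable def totalCost (V : ℝ → ℝ → ℝ) (K S : ℝ) : ℝ :=
  V K S + G.genFixedCost / (1 - G.δ) + G.fS * K / (1 - G.δ)

/-- `K` is optimal for a planner who averages over the distribution `x` of the state of charge at the
time of investment: no other storage volume has a smaller average total cost. -/
def IsOptimalVolume (V : ℝ → ℝ → ℝ) (x : Measure ℝ) (K : ℝ) : Prop :=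
  ∀ K', 0 ≤ K' → ∫ S, G.totalCost V K S ∂x ≤ ∫ S, G.totalCost V K' S ∂x

/-- The load of duration `d`: the largest `l` that the load reaches with probability at least `d`. -/
noncomputable def loadOfDuration (d : ℝ) : ℝ := sSup {l | d ≤ G.load.real (Ici l)}

/-- For the opening state of charge `S`, the area below the discounted expected price in the next
interval and above the price-duration curve. Both are drawn against the duration `d ∈ (0, 1)`. -/
noncomputable def area (σ : ℝ → ℝ → ℝ) (S : ℝ) : ℝ :=
  (volume : Measure (ℝ × ℝ)).real {z | z.1 ∈ Ioo 0 1 ∧ G.price σ S (G.loadOfDuration z.1) ≤ z.2 ∧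
    z.2 ≤ G.δ * G.nextPrice σ S (G.loadOfDuration z.1)}

/-- The expectation `E_{SL}[(δ E[P⁺] - P) · 1(δ E[P⁺] ≥ P)]`. -/
noncomputable def meanExcess (σ : ℝ → ℝ → ℝ) (x : Measure ℝ) : ℝ :=
  ∫ S, ∫ l, {l' | G.price σ S l' ≤ G.δ * G.nextPrice σ S l'}.indicator
    (fun l' => G.δ * G.nextPrice σ S l' - G.price σ S l') l ∂G.load ∂x

end PowerSystem

open Filter Topology ENNReal NNReal

/-! The planner's problem is convex: `dispatchCost` is an infimal convolution of convex costs, and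
the Bellman equation passes convexity on to `V`, jointly in volume and opening charge
(`IsValueFunction.mix_le`). An interior volume is therefore optimal exactly when the derivative of
the average cost vanishes, and the work lies in computing that derivative.

Derivatives come from one envelope principle (`hasDerivAt_of_le_of_midpoint`): a feasible policy
gives a differentiable upper bound that touches the convex value function, which then has the same
derivative. In `S` this gives `V' = -E[P]/Δ`, so the first-order condition compares `P` with `δ
E[P⁺]`: storage closes full where `δ E[P⁺]` is larger and empty where it is smaller
(`integral_mul_charge`).

In `K`, the competitor dilates all states of charge about `Smin`. Since `x` is held fixed, the
dilation of the opening states must be undone; joint convexity does this by writing `(K + h, S)` as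
the midpoint of a dilated point at volume `K + 2h` and a contracted one at volume `K`. Stationarity
of `x` sums the discounted costs, and complementary slackness turns the derivative into `-meanExcess
/ (Δ (1 - δ))`.

The area form follows because the load-duration curve carries the uniform law on `(0, 1)` to the law
of the load. -/

/-! ### Bounded random variables and derivatives of convex functions -/

theorem memLp_top_iff_exists_bound {Ω : Type*} {_ : MeasurableSpace Ω} {μ : Measure Ω} {f : Ω → ℝ} :
    MemLp f ⊤ μ ↔ AEStronglyMeasurable f μ ∧ ∃ B : ℝ, ∀ᵐ ω ∂μ, |f ω| ≤ B := by
  constructor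
  · intro h
    refine ⟨h.1, (eLpNormEssSup f μ).toReal, ?_⟩
    have h2 : eLpNormEssSup f μ ≠ ⊤ := by simpa using h.eLpNorm_ne_top
    filter_upwards [ae_le_eLpNormEssSup (f := f) (μ := μ)] with ω hω
    have := ENNReal.toReal_mono h2 hω
    simpa using this
  · rintro ⟨h, B, hB⟩
    exact memLp_top_of_bound h B (by simpa using hB)

theorem Continuous.comp_memLp_top {Ω : Type*} {_ : MeasurableSpace Ω} {μ : Measure Ω}
    {f : ℝ → ℝ} (hf : Continuous f) {n : Ω → ℝ} (hn : MemLp n ⊤ μ) :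
    MemLp (fun ω => f (n ω)) ⊤ μ := by
  obtain ⟨hm, B, hB⟩ := memLp_top_iff_exists_bound.1 hn
  obtain ⟨C, hC⟩ := (isCompact_Icc (a := -B) (b := B)).exists_bound_of_continuousOn hf.continuousOn
  refine memLp_top_iff_exists_bound.2 ⟨hf.comp_aestronglyMeasurable hm, C, ?_⟩
  filter_upwards [hB] with ω hω
  exact hC _ (abs_le.1 hω)

theorem memLp_top_of_mem_Icc {Ω : Type*} {_ : MeasurableSpace Ω} {μ : Measure Ω} {f : Ω → ℝ}
    (hf : AEStronglyMeasurable f μ) {a b : ℝ} (h : ∀ᵐ ω ∂μ, f ω ∈ Icc a b) : MemLp f ⊤ μ := by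
  refine memLp_top_iff_exists_bound.2 ⟨hf, max |a| |b|, ?_⟩
  filter_upwards [h] with ω hω
  exact abs_le_max_abs_abs hω.1 hω.2

theorem ConvexOn.exists_lipschitzOnWith_Icc {f : ℝ → ℝ} (hf : ConvexOn ℝ univ f) (a b : ℝ) :
    ∃ C : ℝ≥0, LipschitzOnWith C f (Icc a b) :=
  LocallyLipschitzOn.exists_lipschitzOnWith_of_compact isCompact_Icc
    hf.locallyLipschitz.locallyLipschitzOn

theorem ConvexOn.continuous_of_univ {f : ℝ → ℝ} (hf : ConvexOn ℝ univ f) : Continuous f :=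
  hf.locallyLipschitz.continuous

theorem ConvexOn.exists_abs_deriv_le {f : ℝ → ℝ} (hf : ConvexOn ℝ univ f) (B : ℝ) :
    ∃ C : ℝ, ∀ n, |n| ≤ B → |deriv f n| ≤ C := by
  -- The margin of 1 makes the interval a neighbourhood of every `n` with `|n| ≤ B`.
  obtain ⟨C, hC⟩ := hf.exists_lipschitzOnWith_Icc (-B - 1) (B + 1)
  refine ⟨C, fun n hn => norm_deriv_le_of_lipschitzOn (Icc_mem_nhds ?_ ?_) hC⟩
  · linarith [(abs_le.1 hn).1]
  · linarith [(abs_le.1 hn).2]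

theorem ConvexOn.memLp_top_deriv_comp {Ω : Type*} {_ : MeasurableSpace Ω} {μ : Measure Ω}
    {f : ℝ → ℝ} (hf : ConvexOn ℝ univ f) {n : Ω → ℝ} (hn : MemLp n ⊤ μ) :
    MemLp (fun ω => deriv f (n ω)) ⊤ μ := by
  obtain ⟨hm, B, hB⟩ := memLp_top_iff_exists_bound.1 hn
  obtain ⟨C, hC⟩ := hf.exists_abs_deriv_le B
  refine memLp_top_iff_exists_bound.2 ⟨?_, C, ?_⟩
  · exact ((measurable_deriv f).comp_aemeasurable hm.aemeasurable).aestronglyMeasurable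
  · filter_upwards [hB] with ω hω using hC _ hω

/-- Differentiation under the integral sign for convex functions of bounded random variables. -/
theorem ConvexOn.hasDerivAt_integral {Ω : Type*} {_ : MeasurableSpace Ω} {μ : Measure Ω}
    [IsFiniteMeasure μ] {f : ℝ → ℝ} (hf : ConvexOn ℝ univ f) {n m : Ω → ℝ} (hn : MemLp n ⊤ μ)
    (hm : MemLp m ⊤ μ) (hd : ∀ᵐ ω ∂μ, DifferentiableAt ℝ f (n ω)) :
    HasDerivAt (fun ε => ∫ ω, f (n ω + ε * m ω) ∂μ) (∫ ω, deriv f (n ω) * m ω ∂μ) 0 := by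
  obtain ⟨-, B, hB⟩ := memLp_top_iff_exists_bound.1 hn
  obtain ⟨-, B', hB'⟩ := memLp_top_iff_exists_bound.1 hm
  -- For `|ε| ≤ 1` the arguments stay almost surely in this interval, so `C * B'` dominates the
  -- difference quotients.
  obtain ⟨C, hC⟩ := hf.exists_lipschitzOnWith_Icc (-(B + B')) (B + B')
  have hmem : ∀ ε : ℝ, MemLp (fun ω => f (n ω + ε * m ω)) ⊤ μ := fun ε =>
    hf.continuous_of_univ.comp_memLp_top (hn.add (hm.const_mul ε))
  refine (hasDerivAt_integral_of_dominated_loc_of_lip (bound := fun _ => C * B')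
    (Icc_mem_nhds (a := (-1 : ℝ)) (b := 1) (by norm_num) (by norm_num))
    (Eventually.of_forall fun ε => (hmem ε).1) ((hmem 0).integrable le_top)
    ((hf.memLp_top_deriv_comp hn).1.mul hm.1) ?_ (integrable_const _) ?_).2
  · filter_upwards [hB, hB'] with ω h1 h2
    have hin : ∀ ε ∈ Icc (-1 : ℝ) 1, n ω + ε * m ω ∈ Icc (-(B + B')) (B + B') := by
      intro ε hε
      refine abs_le.1 ((abs_add_le _ _).trans (add_le_add h1 ?_))
      rw [abs_mul]
      calc |ε| * |m ω| ≤ 1 * |m ω| := by gcongr; exact abs_le.2 hε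
        _ ≤ B' := by simpa using h2
    refine LipschitzOnWith.of_dist_le_mul fun ε hε ε' hε' => ?_
    refine (hC.dist_le_mul _ (hin ε hε) _ (hin ε' hε')).trans ?_
    have hB0 : 0 ≤ B' := (abs_nonneg _).trans h2
    have : dist (n ω + ε * m ω) (n ω + ε' * m ω) = |m ω| * dist ε ε' := by
      rw [Real.dist_eq, Real.dist_eq, ← abs_mul]; congr 1; ring
    rw [this]
    simp only [Real.coe_nnabs]
    rw [abs_of_nonneg (by positivity : 0 ≤ (C : ℝ) * B'), mul_assoc]
    gcongr
  · filter_upwards [hd] with ω hω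
    have h1 : HasDerivAt (fun ε : ℝ => n ω + ε * m ω) (m ω) 0 := by
      simpa using ((hasDerivAt_id (0 : ℝ)).mul_const (m ω)).const_add (n ω)
    have h2 : HasDerivAt f (deriv f (n ω)) (n ω + 0 * m ω) := by simpa using hω.hasDerivAt
    exact h2.comp (0 : ℝ) h1

/-- A midpoint convex function that is touched from above by a differentiable function is
differentiable at the point of contact, with the same derivative. -/
theorem hasDerivAt_of_le_of_midpoint {f R : ℝ → ℝ} {y r : ℝ} (hR : HasDerivAt R r 0)
    (h0 : R 0 = f y) (hle : ∀ᶠ h in 𝓝 (0 : ℝ), f (y + h) ≤ R h)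
    (hmid : ∀ᶠ h in 𝓝 (0 : ℝ), 2 * f y ≤ f (y + h) + f (y - h)) : HasDerivAt f r y := by
  have key : HasDerivAt (fun h => f (y + h)) r 0 := by
    have hR' : HasDerivAt (fun h => R (-h)) (-r) 0 := by
      have : HasDerivAt R r (-0) := by simpa using hR
      simpa [Function.comp_def] using this.comp (0 : ℝ) (hasDerivAt_neg (0 : ℝ))
    have hneg : Tendsto (fun h : ℝ => -h) (𝓝 0) (𝓝 0) := by simpa using (continuous_neg.tendsto (0:ℝ))
    rw [hasDerivAt_iff_isLittleO] at hR hR' ⊢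
    -- The error of `f` at `h` is at most that of `R` at `h` and, by midpoint convexity, at least
    -- minus that of `R` at `-h`.
    have hsum := hR.norm_left.add hR'.norm_left
    refine Asymptotics.IsBigO.trans_isLittleO (Asymptotics.IsBigO.of_bound 1 ?_) hsum
    filter_upwards [hle, hneg.eventually hle, hmid] with h h1 h2 h3
    simp only [sub_zero, smul_eq_mul, add_zero, neg_zero, Real.norm_eq_abs, one_mul, ← sub_eq_add_neg]
      at *
    rw [abs_of_nonneg (by positivity : 0 ≤ |R h - R 0 - h * r| + |R (-h) - R 0 - h * -r|)]
    refine abs_le.2 ⟨?_, ?_⟩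
    · have := le_abs_self (R (-h) - R 0 - h * -r)
      have := abs_nonneg (R h - R 0 - h * r)
      linarith
    · have := le_abs_self (R h - R 0 - h * r)
      have := abs_nonneg (R (-h) - R 0 - h * -r)
      linarith
  have h2 : HasDerivAt (fun h => f (y + h)) r (y - y) := by simpa using key
  simpa using h2.comp_sub_const y y

theorem HasDerivAt.nonneg_of_le_right {G : ℝ → ℝ} {g : ℝ} (hG : HasDerivAt G g 0)
    (h : ∀ ε ∈ Ioc (0 : ℝ) 1, G 0 ≤ G ε) : 0 ≤ g := by
  refine ge_of_tendsto hG.tendsto_slope_zero_right ?_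
  filter_upwards [Ioc_mem_nhdsGT (zero_lt_one' ℝ)] with ε hε
  have := h ε hε
  have h1 := hε.1
  simp only [zero_add, smul_eq_mul]
  have : 0 ≤ G ε - G 0 := by linarith
  positivity

/-! ### Convexity of the dispatch cost and of the value function -/

namespace PowerSystem

variable {ι : Type*} [Fintype ι] {G : PowerSystem ι} {V : ℝ → ℝ → ℝ} {K S : ℝ}

theorem Servable.exists_dispatch_lt (hG : G.Servable) (n : ℝ) {ε : ℝ} (hε : 0 < ε) :
    ∃ c ∈ G.dispatchCosts n, c < G.dispatchCost n + ε :=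
  exists_lt_of_csInf_lt (hG n).1 (lt_add_of_pos_right _ hε)

/-- The dispatch cost is convex, as an infimal convolution of convex functions. -/
theorem Servable.convexOn_dispatchCost (hG : G.Servable) : ConvexOn ℝ univ G.dispatchCost := by
  refine ⟨convex_univ, fun n₁ _ n₂ _ a b ha hb hab => le_of_forall_pos_le_add fun ε hε => ?_⟩
  -- The infimum need not be attained, so `ε`-optimal dispatches are mixed.
  obtain ⟨_, ⟨Q₁, hn₁, hR₁, rfl⟩, h₁⟩ := hG.exists_dispatch_lt n₁ hε
  obtain ⟨_, ⟨Q₂, hn₂, hR₂, rfl⟩, h₂⟩ := hG.exists_dispatch_lt n₂ hε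
  have hmix : ∑ i, G.runCost i (a * Q₁ i + b * Q₂ i) ∈ G.dispatchCosts (a • n₁ + b • n₂) := by
    refine ⟨fun i => a * Q₁ i + b * Q₂ i, ?_, fun i => ?_, rfl⟩
    · simp [Finset.sum_add_distrib, ← Finset.mul_sum, hn₁, hn₂]
    · exact (G.convexOn_runCost i).1 (hR₁ i) (hR₂ i) ha hb hab
  calc G.dispatchCost (a • n₁ + b • n₂)
      ≤ ∑ i, G.runCost i (a * Q₁ i + b * Q₂ i) := csInf_le (hG _).2 hmix
    _ ≤ ∑ i, (a * G.runCost i (Q₁ i) + b * G.runCost i (Q₂ i)) :=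
        Finset.sum_le_sum fun i _ => (G.convexOn_runCost i).2 (hR₁ i) (hR₂ i) ha hb hab
    _ = a * ∑ i, G.runCost i (Q₁ i) + b * ∑ i, G.runCost i (Q₂ i) := by
        simp [Finset.sum_add_distrib, Finset.mul_sum]
    _ ≤ a * (G.dispatchCost n₁ + ε) + b * (G.dispatchCost n₂ + ε) := by gcongr
    _ = a • G.dispatchCost n₁ + b • G.dispatchCost n₂ + ε := by
        simp only [smul_eq_mul]; linear_combination ε * hab

theorem Servable.continuous_dispatchCost (hG : G.Servable) : Continuous G.dispatchCost :=
  hG.convexOn_dispatchCost.continuous_of_univ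

instance isProbabilityMeasure_load' : IsProbabilityMeasure G.load := G.isProbabilityMeasure_load

theorem memLp_load : MemLp (fun l => l) ⊤ G.load :=
  memLp_top_of_mem_Icc aestronglyMeasurable_id G.load_mem

theorem memLp_netLoad {Ω : Type*} {_ : MeasurableSpace Ω} {μ : Measure Ω} {S L s : Ω → ℝ}
    (hS : MemLp S ⊤ μ) (hL : MemLp L ⊤ μ) (hs : MemLp s ⊤ μ) :
    MemLp (fun ω => G.netLoad (S ω) (L ω) (s ω)) ⊤ μ := by
  have h := hL.sub ((hS.sub hs).const_mul G.Δ⁻¹)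
  have e : (fun ω => G.netLoad (S ω) (L ω) (s ω)) = L - fun ω => G.Δ⁻¹ * (S - s) ω := by
    ext ω; simp only [netLoad, Pi.sub_apply]; ring
  rwa [e]

theorem memLp_top_of_mem_charges {Ω : Type*} {_ : MeasurableSpace Ω} {μ : Measure Ω} {s : Ω → ℝ}
    (hs : AEStronglyMeasurable s μ) (h : ∀ᵐ ω ∂μ, s ω ∈ G.charges K) : MemLp s ⊤ μ :=
  memLp_top_of_mem_Icc hs h

theorem IsValueFunction.memLp_comp (hV : G.IsValueFunction V) (hK : 0 ≤ K) {s : ℝ → ℝ}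
    (hs : Measurable s) (hsK : ∀ l, s l ∈ G.charges K) : MemLp (fun l => V K (s l)) ⊤ G.load := by
  obtain ⟨hm, ⟨A, hA⟩, ⟨B, hB⟩, -⟩ := hV K hK
  refine memLp_top_of_mem_Icc (a := A) (b := B) (hm.comp hs).aestronglyMeasurable (.of_forall fun l => ?_)
  exact ⟨hA (mem_image_of_mem _ (hsK l)), hB (mem_image_of_mem _ (hsK l))⟩

theorem Servable.memLp_dispatchCost (hG : G.Servable) {s : ℝ → ℝ} (hs : Measurable s)
    (hsK : ∀ l, s l ∈ G.charges K) (S : ℝ) :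
    MemLp (fun l => G.dispatchCost (G.netLoad S l (s l))) ⊤ G.load :=
  hG.continuous_dispatchCost.comp_memLp_top (memLp_netLoad (memLp_const S) memLp_load
    (memLp_top_of_mem_charges hs.aestronglyMeasurable (.of_forall hsK)))

theorem IsValueFunction.le_expectedCost (hV : G.IsValueFunction V) (hK : 0 ≤ K) {s : ℝ → ℝ}
    (hs : Measurable s) (hsK : ∀ l, s l ∈ G.charges K) (S : ℝ) :
    V K S ≤ G.expectedCost (V K) S s :=
  ((hV K hK).2.2.2 S).2 ⟨s, hs, hsK, rfl⟩

theorem IsValueFunction.exists_eq_expectedCost (hV : G.IsValueFunction V) (hK : 0 ≤ K) (S : ℝ) :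
    ∃ s : ℝ → ℝ, Measurable s ∧ (∀ l, s l ∈ G.charges K) ∧ V K S = G.expectedCost (V K) S s :=
  ((hV K hK).2.2.2 S).1

theorem IsValueFunction.integrable_cost (hG : G.Servable) (hV : G.IsValueFunction V) (hK : 0 ≤ K)
    {s : ℝ → ℝ} (hs : Measurable s) (hsK : ∀ l, s l ∈ G.charges K) (S : ℝ) :
    Integrable (fun l => G.dispatchCost (G.netLoad S l (s l)) + G.δ * V K (s l)) G.load :=
  ((hG.memLp_dispatchCost hs hsK S).add ((hV.memLp_comp hK hs hsK).const_mul _)).integrable le_top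

theorem IsValueFunction.expectedCost_eq (hG : G.Servable) (hV : G.IsValueFunction V) (hK : 0 ≤ K)
    {s : ℝ → ℝ} (hs : Measurable s) (hsK : ∀ l, s l ∈ G.charges K) (S : ℝ) :
    G.expectedCost (V K) S s =
      ∫ l, G.dispatchCost (G.netLoad S l (s l)) ∂G.load + G.δ * ∫ l, V K (s l) ∂G.load := by
  rw [expectedCost, integral_add ((hG.memLp_dispatchCost hs hsK S).integrable le_top)
    (((hV.memLp_comp hK hs hsK).const_mul _).integrable le_top), integral_const_mul]

theorem mem_charges_mix {K₁ K₂ s₁ s₂ a b : ℝ} (h₁ : s₁ ∈ G.charges K₁) (h₂ : s₂ ∈ G.charges K₂)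
    (ha : 0 ≤ a) (hb : 0 ≤ b) (hab : a + b = 1) :
    a * s₁ + b * s₂ ∈ G.charges (a * K₁ + b * K₂) := by
  have e : G.Smin = a * G.Smin + b * G.Smin := by rw [← add_mul, hab, one_mul]
  constructor
  · calc G.Smin = a * G.Smin + b * G.Smin := e
      _ ≤ _ := by gcongr; exacts [h₁.1, h₂.1]
  · calc a * s₁ + b * s₂ ≤ a * (G.Smin + K₁) + b * (G.Smin + K₂) := by
          gcongr; exacts [h₁.2, h₂.2]
      _ = _ := by linear_combination -e

/-- A bound on the failure of joint convexity on the closing states is improved by the factor `δ`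
when the Bellman equation is applied. -/
theorem IsValueFunction.mix_le_add_of_forall (hG : G.Servable) (hV : G.IsValueFunction V)
    {K₁ K₂ a b M : ℝ} (hK₁ : 0 ≤ K₁) (hK₂ : 0 ≤ K₂) (ha : 0 ≤ a) (hb : 0 ≤ b) (hab : a + b = 1)
    (hM : ∀ S₁ ∈ G.charges K₁, ∀ S₂ ∈ G.charges K₂,
      V (a * K₁ + b * K₂) (a * S₁ + b * S₂) ≤ a * V K₁ S₁ + b * V K₂ S₂ + M) (S₁ S₂ : ℝ) :
    V (a * K₁ + b * K₂) (a * S₁ + b * S₂) ≤ a * V K₁ S₁ + b * V K₂ S₂ + G.δ * M := by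
  obtain ⟨s₁, hs₁, hm₁, e₁⟩ := hV.exists_eq_expectedCost hK₁ S₁
  obtain ⟨s₂, hs₂, hm₂, e₂⟩ := hV.exists_eq_expectedCost hK₂ S₂
  have hK : 0 ≤ a * K₁ + b * K₂ := by positivity
  -- The mixture of the two optimal policies is feasible for the mixed volume. Only closing states
  -- enter the cost to go, so `hM` is needed there alone although `S₁` and `S₂` are arbitrary.
  have hs : Measurable fun l => a * s₁ l + b * s₂ l := (hs₁.const_mul a).add (hs₂.const_mul b)
  have hm := fun l => mem_charges_mix (hm₁ l) (hm₂ l) ha hb hab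
  have i₁ := (hV.integrable_cost hG hK₁ hs₁ hm₁ S₁).const_mul a
  have i₂ := (hV.integrable_cost hG hK₂ hs₂ hm₂ S₂).const_mul b
  have i₃ : Integrable (fun l => a * (G.dispatchCost (G.netLoad S₁ l (s₁ l)) + G.δ * V K₁ (s₁ l)) +
    b * (G.dispatchCost (G.netLoad S₂ l (s₂ l)) + G.δ * V K₂ (s₂ l))) G.load := i₁.add i₂
  refine (hV.le_expectedCost hK hs hm _).trans ?_
  rw [e₁, e₂, expectedCost, expectedCost, expectedCost, ← integral_const_mul, ← integral_const_mul,
    ← integral_add i₁ i₂]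
  have hc : G.δ * M = ∫ _, G.δ * M ∂G.load := by simp
  rw [hc, ← integral_add i₃ (integrable_const _)]
  refine integral_mono (hV.integrable_cost hG hK hs hm _) (i₃.add (integrable_const _))
    fun l => ?_
  have hD := hG.convexOn_dispatchCost.2 (mem_univ (G.netLoad S₁ l (s₁ l)))
    (mem_univ (G.netLoad S₂ l (s₂ l))) ha hb hab
  have hn : a • G.netLoad S₁ l (s₁ l) + b • G.netLoad S₂ l (s₂ l)
      = G.netLoad (a * S₁ + b * S₂) l (a * s₁ l + b * s₂ l) := by
    simp only [netLoad, smul_eq_mul]; linear_combination l * hab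
  rw [hn] at hD
  have hW := mul_le_mul_of_nonneg_left (hM _ (hm₁ l) _ (hm₂ l)) G.δ_nonneg
  simp only [smul_eq_mul] at hD ⊢
  linarith

/-- The value function is jointly convex in the storage volume and the opening state of charge. -/
theorem IsValueFunction.mix_le (hG : G.Servable) (hV : G.IsValueFunction V)
    {K₁ K₂ a b : ℝ} (hK₁ : 0 ≤ K₁) (hK₂ : 0 ≤ K₂) (ha : 0 ≤ a) (hb : 0 ≤ b) (hab : a + b = 1)
    (S₁ S₂ : ℝ) : V (a * K₁ + b * K₂) (a * S₁ + b * S₂) ≤ a * V K₁ S₁ + b * V K₂ S₂ := by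
  have hK : 0 ≤ a * K₁ + b * K₂ := by positivity
  obtain ⟨-, ⟨A₁, hA₁⟩, -, -⟩ := hV K₁ hK₁
  obtain ⟨-, ⟨A₂, hA₂⟩, -, -⟩ := hV K₂ hK₂
  obtain ⟨-, -, ⟨B, hB⟩, -⟩ := hV _ hK
  -- Boundedness of `V` on the closing states gives some initial defect; each use of the Bellman
  -- equation shrinks it by `δ`, so it is zero in the limit.
  have key : ∀ k : ℕ, ∀ S₁ ∈ G.charges K₁, ∀ S₂ ∈ G.charges K₂,
      V (a * K₁ + b * K₂) (a * S₁ + b * S₂) ≤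
        a * V K₁ S₁ + b * V K₂ S₂ + G.δ ^ k * (B - a * A₁ - b * A₂) := by
    intro k
    induction k with
    | zero =>
      intro S₁ h₁ S₂ h₂
      have b₁ := mul_le_mul_of_nonneg_left (hA₁ (mem_image_of_mem _ h₁)) ha
      have b₂ := mul_le_mul_of_nonneg_left (hA₂ (mem_image_of_mem _ h₂)) hb
      have b₃ := hB (mem_image_of_mem _ (mem_charges_mix h₁ h₂ ha hb hab))
      simp only [pow_zero, one_mul]
      linarith
    | succ k ih =>
      intro S₁ _ S₂ _
      have := hV.mix_le_add_of_forall hG hK₁ hK₂ ha hb hab ih S₁ S₂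
      rwa [← mul_assoc, ← pow_succ'] at this
  have h0 : ∀ S₁ ∈ G.charges K₁, ∀ S₂ ∈ G.charges K₂,
      V (a * K₁ + b * K₂) (a * S₁ + b * S₂) ≤ a * V K₁ S₁ + b * V K₂ S₂ + 0 := by
    intro S₁ h₁ S₂ h₂
    have h := ((tendsto_pow_atTop_nhds_zero_of_lt_one G.δ_nonneg G.δ_lt_one).mul_const
      (B - a * A₁ - b * A₂)).const_add (a * V K₁ S₁ + b * V K₂ S₂)
    rw [zero_mul] at h
    exact ge_of_tendsto h (Eventually.of_forall fun k => key k S₁ h₁ S₂ h₂)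
  -- One more use, with zero defect, extends the inequality to all opening states.
  simpa using hV.mix_le_add_of_forall hG hK₁ hK₂ ha hb hab h0 S₁ S₂

theorem IsValueFunction.convexOn (hG : G.Servable) (hV : G.IsValueFunction V) (hK : 0 ≤ K) :
    ConvexOn ℝ univ (V K) := by
  refine ⟨convex_univ, fun S₁ _ S₂ _ a b ha hb hab => ?_⟩
  have := hV.mix_le hG hK hK ha hb hab S₁ S₂
  rwa [← add_mul, hab, one_mul] at this

theorem IsValueFunction.continuous (hG : G.Servable) (hV : G.IsValueFunction V) (hK : 0 ≤ K) :
    Continuous (V K) :=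
  (hV.convexOn hG hK).continuous_of_univ

end PowerSystem

/-! ### Prices as marginal values and the first-order conditions of the policy -/

namespace PowerSystem

variable {ι : Type*} [Fintype ι] {G : PowerSystem ι} {V : ℝ → ℝ → ℝ} {K S : ℝ} {σ : ℝ → ℝ → ℝ}

/-- The expected price in an interval that opens in the state of charge `S`. -/
noncomputable def meanPrice (G : PowerSystem ι) (σ : ℝ → ℝ → ℝ) (S : ℝ) : ℝ :=
  ∫ l, G.price σ S l ∂G.load

theorem nextPrice_eq (S l : ℝ) : G.nextPrice σ S l = G.meanPrice σ (σ S l) := rfl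

theorem measurable_price (hσ : Measurable (Function.uncurry σ)) :
    Measurable (Function.uncurry (G.price σ)) := by
  refine (measurable_deriv G.dispatchCost).comp ?_
  exact measurable_snd.sub ((measurable_fst.sub hσ).div_const _)

theorem measurable_meanPrice (hσ : Measurable (Function.uncurry σ)) :
    Measurable (G.meanPrice σ) :=
  (StronglyMeasurable.integral_prod_right
    (measurable_price (G := G) hσ).stronglyMeasurable).measurable

theorem measurable_nextPrice (hσ : Measurable (Function.uncurry σ)) :
    Measurable (Function.uncurry (G.nextPrice σ)) :=
  (measurable_meanPrice hσ).comp hσ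

theorem IsOptimalPolicy.measurable_right (hσ : G.IsOptimalPolicy V K σ) (S : ℝ) :
    Measurable (σ S) :=
  hσ.1.comp measurable_prodMk_left

theorem IsOptimalPolicy.memLp (hσ : G.IsOptimalPolicy V K σ) (hS : S ∈ G.charges K) :
    MemLp (σ S) ⊤ G.load :=
  memLp_top_of_mem_charges (hσ.measurable_right S).aestronglyMeasurable
    (.of_forall (hσ.2 S hS).1)

theorem IsOptimalPolicy.memLp_netLoad (hσ : G.IsOptimalPolicy V K σ) (hS : S ∈ G.charges K) :
    MemLp (fun l => G.netLoad S l (σ S l)) ⊤ G.load :=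
  PowerSystem.memLp_netLoad (memLp_const S) memLp_load (hσ.memLp hS)

/-- The marginal value of the state of charge is the expected price per unit of time. -/
theorem IsOptimalPolicy.hasDerivAt_value (hG : G.Servable) (hV : G.IsValueFunction V) (hK : 0 ≤ K)
    (hσ : G.IsOptimalPolicy V K σ) (hP : G.HasPrices K σ) (hS : S ∈ G.charges K) :
    HasDerivAt (V K) (-G.meanPrice σ S / G.Δ) S := by
  have hs := hσ.measurable_right S
  have hsK := (hσ.2 S hS).1
  -- Envelope argument: the closing states chosen at `S` remain feasible from `S + h`, and their
  -- cost touches `V K` from above at `h = 0`.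
  have hR := (hG.convexOn_dispatchCost.hasDerivAt_integral (hσ.memLp_netLoad hS)
    (memLp_const (-G.Δ⁻¹)) (hP S hS)).add_const (G.δ * ∫ l, V K (σ S l) ∂G.load)
  have hn : ∀ h l, G.netLoad (S + h) l (σ S l) = G.netLoad S l (σ S l) + h * -G.Δ⁻¹ := by
    intro h l; simp only [netLoad]; ring
  have hd : ∫ l, deriv G.dispatchCost (G.netLoad S l (σ S l)) * -G.Δ⁻¹ ∂G.load
      = -G.meanPrice σ S / G.Δ := by
    rw [integral_mul_const, meanPrice]; simp only [price]; ring
  rw [hd] at hR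
  refine hasDerivAt_of_le_of_midpoint hR ?_ (.of_forall fun h => ?_) (.of_forall fun h => ?_)
  · rw [(hσ.2 S hS).2, hV.expectedCost_eq hG hK hs hsK]; simp
  · refine (hV.le_expectedCost hK hs hsK (S + h)).trans_eq ?_
    rw [hV.expectedCost_eq hG hK hs hsK]; simp only [hn]
  · have := (hV.convexOn hG hK).2 (mem_univ (S + h)) (mem_univ (S - h))
      (by norm_num : (0 : ℝ) ≤ 1 / 2) (by norm_num : (0 : ℝ) ≤ 1 / 2) (by norm_num)
    simp only [smul_eq_mul] at this
    rw [show 1 / 2 * (S + h) + 1 / 2 * (S - h) = S by ring] at this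
    linarith

theorem IsOptimalPolicy.meanPrice_eq (hG : G.Servable) (hV : G.IsValueFunction V) (hK : 0 ≤ K)
    (hσ : G.IsOptimalPolicy V K σ) (hP : G.HasPrices K σ) (hS : S ∈ G.charges K) :
    G.meanPrice σ S = -G.Δ * deriv (V K) S := by
  have := G.Δ_pos
  rw [(hσ.hasDerivAt_value hG hV hK hP hS).deriv]; field_simp

/-- Boundedness comes from the local Lipschitz property of the convex function `V K`, of which the
mean price is a multiple of the slope. -/
theorem IsOptimalPolicy.memLp_meanPrice (hG : G.Servable) (hV : G.IsValueFunction V) (hK : 0 ≤ K)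
    (hσ : G.IsOptimalPolicy V K σ) (hP : G.HasPrices K σ) {Ω : Type*} {_ : MeasurableSpace Ω}
    {μ : Measure Ω} {s : Ω → ℝ} (hs : AEStronglyMeasurable s μ)
    (hsK : ∀ᵐ ω ∂μ, s ω ∈ G.charges K) : MemLp (fun ω => G.meanPrice σ (s ω)) ⊤ μ := by
  refine (memLp_congr_ae ?_).1
    (((hV.convexOn hG hK).memLp_top_deriv_comp (memLp_top_of_mem_charges hs hsK)).const_mul (-G.Δ))
  filter_upwards [hsK] with ω hω
  exact (hσ.meanPrice_eq hG hV hK hP hω).symm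

theorem IsOptimalPolicy.memLp_price (hG : G.Servable) (hσ : G.IsOptimalPolicy V K σ)
    (hS : S ∈ G.charges K) : MemLp (G.price σ S) ⊤ G.load :=
  hG.convexOn_dispatchCost.memLp_top_deriv_comp (hσ.memLp_netLoad hS)

/-- First-order condition: closing states of charge that move towards `t` do not lower the cost. -/
theorem IsOptimalPolicy.integral_nonneg (hG : G.Servable) (hV : G.IsValueFunction V) (hK : 0 ≤ K)
    (hσ : G.IsOptimalPolicy V K σ) (hP : G.HasPrices K σ) (hS : S ∈ G.charges K) {t : ℝ → ℝ}
    (ht : Measurable t) (htK : ∀ l, t l ∈ G.charges K) :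
    0 ≤ ∫ l, (G.price σ S l - G.δ * G.nextPrice σ S l) * (t l - σ S l) ∂G.load := by
  have hΔ := G.Δ_pos
  have hs := hσ.measurable_right S
  have hsK := (hσ.2 S hS).1
  have hm : MemLp (fun l => t l - σ S l) ⊤ G.load :=
    (memLp_top_of_mem_charges ht.aestronglyMeasurable (.of_forall htK)).sub (hσ.memLp hS)
  -- `h₁` and `h₂` differentiate the present cost and the cost to go along the segment from `σ S` to
  -- `t`, which is feasible because `charges K` is an interval.
  have h₁ := hG.convexOn_dispatchCost.hasDerivAt_integral (hσ.memLp_netLoad hS)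
    (hm.mul_const G.Δ⁻¹) (hP S hS)
  have h₂ := ((hV.convexOn hG hK).hasDerivAt_integral (hσ.memLp hS) hm (.of_forall fun l =>
    (hσ.hasDerivAt_value hG hV hK hP (hsK l)).differentiableAt)).const_mul G.δ
  have hle := (h₁.add h₂).nonneg_of_le_right fun ε hε => by
    have hε' : ∀ l, σ S l + ε * (t l - σ S l) ∈ G.charges K := fun l => by
      have := (convex_Icc G.Smin (G.Smin + K)) (hsK l) (htK l) (sub_nonneg.2 hε.2) hε.1.le
        (by ring)
      have e : σ S l + ε * (t l - σ S l) = (1 - ε) • σ S l + ε • t l := by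
        simp only [smul_eq_mul]; ring
      rw [e]; exact this
    have hm' : Measurable fun l => σ S l + ε * (t l - σ S l) := hs.add ((ht.sub hs).const_mul ε)
    have := hV.le_expectedCost hK hm' hε' S
    rw [(hσ.2 S hS).2, hV.expectedCost_eq hG hK hs hsK, hV.expectedCost_eq hG hK hm' hε'] at this
    have hn : ∀ l, G.netLoad S l (σ S l + ε * (t l - σ S l))
        = G.netLoad S l (σ S l) + ε * ((t l - σ S l) * G.Δ⁻¹) := by
      intro l; simp only [netLoad]; ring
    simpa [hn] using this
  have i₁ := ((hm.mul_const G.Δ⁻¹).mul' (r := ⊤) (hσ.memLp_price hG hS)).integrable le_top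
  have i₂ := ((hm.mul' (r := ⊤) ((hV.convexOn hG hK).memLp_top_deriv_comp
    (hσ.memLp hS))).const_mul G.δ).integrable le_top
  rw [← integral_const_mul] at hle
  have e := integral_add i₁ i₂
  simp only [price] at e
  rw [← e, ← mul_nonneg_iff_of_pos_left hΔ, ← integral_const_mul] at hle
  refine hle.trans_eq (integral_congr_ae (.of_forall fun l => ?_))
  simp only [nextPrice_eq, hσ.meanPrice_eq hG hV hK hP (hsK l), price]
  field_simp
  ring

/-- The integrand of `meanExcess`. -/
noncomputable def excess (G : PowerSystem ι) (σ : ℝ → ℝ → ℝ) (S l : ℝ) : ℝ :=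
  {l' | G.price σ S l' ≤ G.δ * G.nextPrice σ S l'}.indicator
    (fun l' => G.δ * G.nextPrice σ S l' - G.price σ S l') l

theorem excess_eq_max (S l : ℝ) :
    G.excess σ S l = max (G.δ * G.nextPrice σ S l - G.price σ S l) 0 := by
  by_cases h : G.price σ S l ≤ G.δ * G.nextPrice σ S l
  · rw [excess, indicator_of_mem (by exact h), max_eq_left (by linarith)]
  · rw [excess, indicator_of_notMem (by exact h), max_eq_right (by linarith)]

theorem meanExcess_eq (x : Measure ℝ) :
    G.meanExcess σ x = ∫ S, ∫ l, G.excess σ S l ∂G.load ∂x := rfl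

/-- Complementary slackness: the discounted next price exceeds the price only when the storage
closes full, and falls short of it only when the storage closes empty. -/
theorem IsOptimalPolicy.integral_mul_charge (hG : G.Servable) (hV : G.IsValueFunction V)
    (hK : 0 ≤ K) (hσ : G.IsOptimalPolicy V K σ) (hP : G.HasPrices K σ) (hS : S ∈ G.charges K) :
    ∫ l, (G.price σ S l - G.δ * G.nextPrice σ S l) * (σ S l - G.Smin) ∂G.load
      = -K * ∫ l, G.excess σ S l ∂G.load := by
  have hsK := (hσ.2 S hS).1
  have mp : Measurable (G.price σ S) := (measurable_price hσ.1).comp measurable_prodMk_left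
  have mq : Measurable (G.nextPrice σ S) := (measurable_nextPrice hσ.1).comp measurable_prodMk_left
  set A := {l | G.price σ S l ≤ G.δ * G.nextPrice σ S l} with hA
  have mA : MeasurableSet A := measurableSet_le mp (mq.const_mul _)
  -- Bang-bang test policy: close full on `A`, empty elsewhere. Its first-order integrand is
  -- pointwise nonpositive while the integral is nonnegative, so the integral vanishes.
  set t : ℝ → ℝ := A.indicator (fun _ => K) + fun _ => G.Smin with ht_def
  have ht : Measurable t := (measurable_const.indicator mA).add measurable_const
  have htin : ∀ l ∈ A, t l = G.Smin + K := fun l hl => by simp [ht_def, hl, add_comm]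
  have htout : ∀ l ∉ A, t l = G.Smin := fun l hl => by simp [ht_def, hl]
  have htK : ∀ l, t l ∈ G.charges K := fun l => by
    by_cases hl : l ∈ A
    · rw [htin l hl]; exact right_mem_Icc.2 (by linarith)
    · rw [htout l hl]; exact left_mem_Icc.2 (by linarith)
  have hge := hσ.integral_nonneg hG hV hK hP hS ht htK
  have hle : ∫ l, (G.price σ S l - G.δ * G.nextPrice σ S l) * (t l - σ S l) ∂G.load ≤ 0 := by
    refine integral_nonpos fun l => ?_
    by_cases hl : l ∈ A
    · have h₁ : G.price σ S l ≤ G.δ * G.nextPrice σ S l := hl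
      have h₂ := (hsK l).2
      rw [htin l hl]
      exact mul_nonpos_of_nonpos_of_nonneg (by linarith) (by linarith)
    · have h₁ : ¬ G.price σ S l ≤ G.δ * G.nextPrice σ S l := hl
      have h₂ := (hsK l).1
      rw [htout l hl]
      exact mul_nonpos_of_nonneg_of_nonpos (by linarith) (by linarith)
  have hq : MemLp (fun l => G.price σ S l - G.δ * G.nextPrice σ S l) ⊤ G.load :=
    (hσ.memLp_price hG hS).sub ((hσ.memLp_meanPrice hG hV hK hP
      (hσ.measurable_right S).aestronglyMeasurable (.of_forall hsK)).const_mul G.δ)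
  have hm : MemLp (fun l => t l - σ S l) ⊤ G.load :=
    (memLp_top_of_mem_charges ht.aestronglyMeasurable (.of_forall htK)).sub (hσ.memLp hS)
  have hm' : MemLp (fun l => σ S l - G.Smin) ⊤ G.load := (hσ.memLp hS).sub (memLp_const _)
  -- Adding the vanishing integral replaces `σ S l - Smin` by `t l - Smin`, which is `K` on `A` and
  -- `0` off it.
  have e := integral_add ((hm.mul' (r := ⊤) hq).integrable le_top)
    ((hm'.mul' (r := ⊤) hq).integrable le_top)
  rw [le_antisymm hle hge, zero_add] at e
  rw [← e, ← integral_const_mul]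
  refine integral_congr_ae (.of_forall fun l => ?_)
  simp only [excess_eq_max]
  by_cases hl : l ∈ A
  · have h₁ : G.price σ S l ≤ G.δ * G.nextPrice σ S l := hl
    simp only [htin l hl]
    rw [max_eq_left (by linarith)]; ring
  · have h₁ : ¬ G.price σ S l ≤ G.δ * G.nextPrice σ S l := hl
    simp only [htout l hl]
    rw [max_eq_right (by linarith)]; ring

end PowerSystem

/-! ### Stationary averages and the marginal value of volume -/

namespace PowerSystem

variable {ι : Type*} [Fintype ι] {G : PowerSystem ι} {V : ℝ → ℝ → ℝ} {K : ℝ} {σ : ℝ → ℝ → ℝ}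
  {x : Measure ℝ}

/-- Stationarity in this form lets averages over the closing state be traded for averages over the
opening state. -/
theorem IsStationary.map_eq (hx : G.IsStationary K σ x) (hσ : Measurable (Function.uncurry σ)) :
    (x.prod G.load).map (Function.uncurry σ) = x := by
  ext A hA
  rw [Measure.map_apply hσ hA, Measure.prod_apply (hσ hA), ← hx.2.2 A hA]
  rfl

theorem IsStationary.integral_policy (hx : G.IsStationary K σ x)
    (hσ : Measurable (Function.uncurry σ)) {φ : ℝ → ℝ} (hφ : AEStronglyMeasurable φ x) :
    ∫ ω, φ (σ ω.1 ω.2) ∂x.prod G.load = ∫ S, φ S ∂x := by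
  have h := integral_map (μ := x.prod G.load) hσ.aemeasurable (f := φ) (by rwa [hx.map_eq hσ])
  rw [hx.map_eq hσ] at h
  exact h.symm

theorem IsStationary.ae_fst (hx : G.IsStationary K σ x) :
    ∀ᵐ ω ∂x.prod G.load, ω.1 ∈ G.charges K := by
  have := hx.1
  exact Measure.quasiMeasurePreserving_fst.ae hx.2.1

theorem IsStationary.memLp_fst (hx : G.IsStationary K σ x) :
    MemLp (fun ω : ℝ × ℝ => ω.1) ⊤ (x.prod G.load) :=
  memLp_top_of_mem_charges measurable_fst.aestronglyMeasurable hx.ae_fst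

theorem IsStationary.memLp_id (hx : G.IsStationary K σ x) : MemLp (fun S : ℝ => S) ⊤ x :=
  memLp_top_of_mem_charges aestronglyMeasurable_id hx.2.1

theorem memLp_snd : MemLp (fun ω : ℝ × ℝ => ω.2) ⊤ (x.prod G.load) :=
  memLp_top_of_mem_Icc measurable_snd.aestronglyMeasurable
    (Measure.quasiMeasurePreserving_snd.ae G.load_mem)

theorem IsStationary.ae_policy (hx : G.IsStationary K σ x) (hσ : G.IsOptimalPolicy V K σ) :
    ∀ᵐ ω ∂x.prod G.load, σ ω.1 ω.2 ∈ G.charges K := by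
  filter_upwards [hx.ae_fst] with ω hω using (hσ.2 _ hω).1 _

theorem IsStationary.memLp_policy (hx : G.IsStationary K σ x) (hσ : G.IsOptimalPolicy V K σ) :
    MemLp (fun ω : ℝ × ℝ => σ ω.1 ω.2) ⊤ (x.prod G.load) :=
  memLp_top_of_mem_charges (s := fun ω : ℝ × ℝ => σ ω.1 ω.2) hσ.1.aestronglyMeasurable
    (hx.ae_policy hσ)

theorem IsStationary.memLp_netLoad (hx : G.IsStationary K σ x) (hσ : G.IsOptimalPolicy V K σ) :
    MemLp (fun ω : ℝ × ℝ => G.netLoad ω.1 ω.2 (σ ω.1 ω.2)) ⊤ (x.prod G.load) :=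
  PowerSystem.memLp_netLoad hx.memLp_fst memLp_snd (hx.memLp_policy hσ)

theorem IsStationary.ae_differentiableAt (hx : G.IsStationary K σ x)
    (hσ : Measurable (Function.uncurry σ)) (hP : G.HasPrices K σ) :
    ∀ᵐ ω ∂x.prod G.load, DifferentiableAt ℝ G.dispatchCost (G.netLoad ω.1 ω.2 (σ ω.1 ω.2)) := by
  have hm : Measurable fun ω : ℝ × ℝ => G.netLoad ω.1 ω.2 (σ ω.1 ω.2) :=
    measurable_snd.sub ((measurable_fst.sub hσ).div_const _)
  refine (Measure.ae_prod_iff_ae_ae (hm (measurableSet_of_differentiableAt ℝ G.dispatchCost))).2 ?_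
  filter_upwards [hx.2.1] with S hS using hP S hS

theorem IsStationary.memLp_value (hG : G.Servable) (hV : G.IsValueFunction V)
    (hx : G.IsStationary K σ x) {K' : ℝ} (hK' : 0 ≤ K') {φ : ℝ → ℝ} (hφ : Continuous φ) :
    MemLp (fun S => V K' (φ S)) ⊤ x :=
  ((hV.continuous hG hK').comp hφ).comp_memLp_top hx.memLp_id

theorem IsStationary.memLp_value_policy (hG : G.Servable) (hV : G.IsValueFunction V)
    (hx : G.IsStationary K σ x) (hσ : G.IsOptimalPolicy V K σ) {K' : ℝ} (hK' : 0 ≤ K')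
    {φ : ℝ → ℝ} (hφ : Continuous φ) :
    MemLp (fun ω : ℝ × ℝ => V K' (φ (σ ω.1 ω.2))) ⊤ (x.prod G.load) :=
  ((hV.continuous hG hK').comp hφ).comp_memLp_top (hx.memLp_policy hσ)

theorem IsStationary.memLp_cost (hG : G.Servable) (hx : G.IsStationary K σ x)
    (hσ : G.IsOptimalPolicy V K σ) {φ ψ : ℝ → ℝ} (hφ : Continuous φ) (hψ : Continuous ψ) :
    MemLp (fun ω : ℝ × ℝ => G.dispatchCost (G.netLoad (φ ω.1) ω.2 (ψ (σ ω.1 ω.2)))) ⊤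
      (x.prod G.load) :=
  hG.continuous_dispatchCost.comp_memLp_top (PowerSystem.memLp_netLoad
    (hφ.comp_memLp_top hx.memLp_fst) memLp_snd (hψ.comp_memLp_top (hx.memLp_policy hσ)))

theorem IsStationary.integral_expectedCost (hG : G.Servable) (hV : G.IsValueFunction V)
    (hx : G.IsStationary K σ x) (hσ : G.IsOptimalPolicy V K σ) {K' : ℝ} (hK' : 0 ≤ K')
    {φ ψ : ℝ → ℝ} (hφ : Continuous φ) (hψ : Continuous ψ) :
    Integrable (fun S => G.expectedCost (V K') (φ S) fun l => ψ (σ S l)) x ∧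
    ∫ S, G.expectedCost (V K') (φ S) (fun l => ψ (σ S l)) ∂x =
      ∫ ω, G.dispatchCost (G.netLoad (φ ω.1) ω.2 (ψ (σ ω.1 ω.2))) ∂x.prod G.load
        + G.δ * ∫ S, V K' (ψ S) ∂x := by
  have := hx.1
  have i₁ := (hx.memLp_cost hG hσ hφ hψ).integrable le_top
  have i₂ := ((hx.memLp_value_policy hG hV hσ hK' hψ).const_mul G.δ).integrable le_top
  refine ⟨(i₁.add i₂).integral_prod_left, ?_⟩
  rw [← hx.integral_policy hσ.1 (φ := fun S => V K' (ψ S)) (hx.memLp_value hG hV hK' hψ).1,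
    ← integral_const_mul, ← integral_add i₁ i₂]
  exact (integral_prod _ (i₁.add i₂)).symm

/-- The policy obtained from an optimal policy for `K` by relabelling the opening states of charge
with `φ` and the closing ones with `ψ` is feasible for the volume `K'`. -/
theorem IsStationary.integral_value_le (hG : G.Servable) (hV : G.IsValueFunction V)
    (hx : G.IsStationary K σ x) (hσ : G.IsOptimalPolicy V K σ) {K' : ℝ} (hK' : 0 ≤ K')
    {φ ψ : ℝ → ℝ} (hφ : Continuous φ) (hψ : Continuous ψ)
    (hψK : ∀ s ∈ G.charges K, ψ s ∈ G.charges K') :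
    ∫ S, V K' (φ S) ∂x ≤
      ∫ ω, G.dispatchCost (G.netLoad (φ ω.1) ω.2 (ψ (σ ω.1 ω.2))) ∂x.prod G.load
        + G.δ * ∫ S, V K' (ψ S) ∂x := by
  have := hx.1
  obtain ⟨hi, he⟩ := hx.integral_expectedCost hG hV hσ hK' hφ hψ
  rw [← he]
  refine integral_mono_ae ((hx.memLp_value hG hV hK' hφ).integrable le_top) hi ?_
  filter_upwards [hx.2.1] with S hS
  exact hV.le_expectedCost hK' (hψ.measurable.comp (hσ.measurable_right S))
    (fun l => hψK _ ((hσ.2 S hS).1 l)) _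

theorem IsStationary.integral_value_eq (hG : G.Servable) (hV : G.IsValueFunction V)
    (hx : G.IsStationary K σ x) (hσ : G.IsOptimalPolicy V K σ) (hK : 0 ≤ K) :
    ∫ S, V K S ∂x =
      ∫ ω, G.dispatchCost (G.netLoad ω.1 ω.2 (σ ω.1 ω.2)) ∂x.prod G.load
        + G.δ * ∫ S, V K S ∂x := by
  refine Eq.trans (integral_congr_ae ?_)
    (hx.integral_expectedCost hG hV hσ hK continuous_id continuous_id).2
  filter_upwards [hx.2.1] with S hS using (hσ.2 S hS).2

/-- Expected revenue identity behind the marginal value of volume. -/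
theorem IsStationary.integral_price_mul (hG : G.Servable) (hV : G.IsValueFunction V)
    (hx : G.IsStationary K σ x) (hK : 0 ≤ K) (hσ : G.IsOptimalPolicy V K σ)
    (hP : G.HasPrices K σ) :
    ∫ ω, G.price σ ω.1 ω.2 * (σ ω.1 ω.2 - G.Smin) ∂x.prod G.load
      - G.δ * ∫ ω, G.price σ ω.1 ω.2 * (ω.1 - G.Smin) ∂x.prod G.load
      = -K * G.meanExcess σ x := by
  have := hx.1
  have mP : MemLp (fun ω : ℝ × ℝ => G.price σ ω.1 ω.2) ⊤ (x.prod G.load) :=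
    hG.convexOn_dispatchCost.memLp_top_deriv_comp (hx.memLp_netLoad hσ)
  have mq : MemLp (fun ω : ℝ × ℝ => G.meanPrice σ (σ ω.1 ω.2)) ⊤ (x.prod G.load) :=
    hσ.memLp_meanPrice (s := fun ω : ℝ × ℝ => σ ω.1 ω.2) hG hV hK hP hσ.1.aestronglyMeasurable
      (hx.ae_policy hσ)
  have ms : MemLp (fun ω : ℝ × ℝ => σ ω.1 ω.2 - G.Smin) ⊤ (x.prod G.load) :=
    (hx.memLp_policy hσ).sub (memLp_const _)
  have mS : MemLp (fun ω : ℝ × ℝ => ω.1 - G.Smin) ⊤ (x.prod G.load) :=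
    hx.memLp_fst.sub (memLp_const _)
  -- By stationarity the opening state may be replaced by the closing one, which turns the price
  -- into the expected next price.
  have e₁ : ∫ ω, G.price σ ω.1 ω.2 * (ω.1 - G.Smin) ∂x.prod G.load
      = ∫ ω, G.meanPrice σ (σ ω.1 ω.2) * (σ ω.1 ω.2 - G.Smin) ∂x.prod G.load := by
    rw [hx.integral_policy hσ.1 (φ := fun S => G.meanPrice σ S * (S - G.Smin))
      ((measurable_meanPrice hσ.1).mul (measurable_id.sub_const _)).aestronglyMeasurable,
      integral_prod _ ((mS.mul' (r := ⊤) mP).integrable le_top)]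
    simp only [integral_mul_const, meanPrice]
  have i₁ := (ms.mul' (r := ⊤) mP).integrable le_top
  have i₂ := ((ms.mul' (r := ⊤) mq).const_mul G.δ).integrable le_top
  rw [e₁, ← integral_const_mul, ← integral_sub i₁ i₂, meanExcess_eq, ← integral_const_mul]
  refine (integral_prod _ (i₁.sub i₂)).trans (integral_congr_ae ?_)
  filter_upwards [hx.2.1] with S hS
  rw [← hσ.integral_mul_charge hG hV hK hP hS]
  refine integral_congr_ae (.of_forall fun l => ?_)
  simp only [nextPrice_eq, Pi.sub_apply]
  ring

/-- Dilation about `Smin` by the factor `(K + h) / K` keeps the relative filling of the storage. -/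
theorem scale_mem_charges (hK : 0 < K) {h s : ℝ} (hKh : 0 ≤ K + h) (hs : s ∈ G.charges K) :
    s + h / K * (s - G.Smin) ∈ G.charges (K + h) := by
  have e : s + h / K * (s - G.Smin) = G.Smin + (K + h) * ((s - G.Smin) / K) := by
    field_simp; ring
  have h₁ : 0 ≤ (s - G.Smin) / K := div_nonneg (by linarith [hs.1]) hK.le
  have h₂ : (s - G.Smin) / K ≤ 1 := (div_le_one hK).2 (by linarith [hs.2])
  rw [e]
  constructor
  · nlinarith
  · nlinarith

theorem IsStationary.convexOn_integral_value (hG : G.Servable) (hV : G.IsValueFunction V)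
    (hx : G.IsStationary K σ x) : ConvexOn ℝ (Ici 0) fun K' => ∫ S, V K' S ∂x := by
  have := hx.1
  refine ⟨convex_Ici 0, fun K₁ h₁ K₂ h₂ a b ha hb hab => ?_⟩
  have i : ∀ {K'}, 0 ≤ K' → Integrable (fun S => V K' S) x := fun h =>
    (hx.memLp_value hG hV h continuous_id).integrable le_top
  have hK : 0 ≤ a * K₁ + b * K₂ := add_nonneg (mul_nonneg ha h₁) (mul_nonneg hb h₂)
  simp only [smul_eq_mul]
  rw [← integral_const_mul, ← integral_const_mul, ← integral_add ((i h₁).const_mul a)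
    ((i h₂).const_mul b)]
  refine integral_mono (i hK) (((i h₁).const_mul a).add ((i h₂).const_mul b)) fun S => ?_
  have := hV.mix_le hG h₁ h₂ ha hb hab S S
  rwa [← add_mul, hab, one_mul] at this

/-- The marginal value of storage volume. -/
theorem IsStationary.hasDerivAt_integral_value (hG : G.Servable) (hV : G.IsValueFunction V)
    (hx : G.IsStationary K σ x) (hK : 0 < K) (hσ : G.IsOptimalPolicy V K σ)
    (hP : G.HasPrices K σ) :
    HasDerivAt (fun K' => ∫ S, V K' S ∂x) (-(G.meanExcess σ x / (G.Δ * (1 - G.δ)))) K := by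
  have := hx.1
  have hΔ := G.Δ_pos
  have hδ : 0 < 1 - G.δ := sub_pos.2 G.δ_lt_one
  set D := ∫ S, V K S ∂x with hD
  have mn := hx.memLp_netLoad hσ
  have ms := hx.memLp_policy hσ
  have mS := hx.memLp_fst
  have hd := hx.ae_differentiableAt hσ.1 hP
  have mP : MemLp (fun ω : ℝ × ℝ => G.price σ ω.1 ω.2) ⊤ (x.prod G.load) :=
    hG.convexOn_dispatchCost.memLp_top_deriv_comp mn
  have mA : MemLp (fun ω : ℝ × ℝ => ω.1 - G.Smin) ⊤ (x.prod G.load) := mS.sub (memLp_const _)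
  have mB : MemLp (fun ω : ℝ × ℝ => σ ω.1 ω.2 - G.Smin) ⊤ (x.prod G.load) :=
    ms.sub (memLp_const _)
  -- Shifts of the net load per unit of `h`: `m₁` when opening and closing states are both dilated
  -- by `2h / K`, `m₂` when only the opening state is contracted by as much.
  set m₁ : ℝ × ℝ → ℝ := fun ω => 2 / (K * G.Δ) * ((σ ω.1 ω.2 - G.Smin) - (ω.1 - G.Smin)) with hm₁
  set m₂ : ℝ × ℝ → ℝ := fun ω => 2 / (K * G.Δ) * (ω.1 - G.Smin) with hm₂
  have R₁ := hG.convexOn_dispatchCost.hasDerivAt_integral mn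
    (show MemLp m₁ ⊤ (x.prod G.load) from (mB.sub mA).const_mul _) hd
  have R₂ := hG.convexOn_dispatchCost.hasDerivAt_integral mn
    (show MemLp m₂ ⊤ (x.prod G.load) from mA.const_mul _) hd
  have R := ((R₁.const_mul (1 - G.δ)⁻¹).fun_add (R₂.add_const (G.δ * D))).const_mul (1 / 2)
  have eD := hx.integral_value_eq hG hV hσ hK.le
  rw [← hD] at eD
  have i₁ := (mA.mul' (r := ⊤) mP).integrable le_top
  have i₂ := (mB.mul' (r := ⊤) mP).integrable le_top
  have d₁ : ∫ ω, deriv G.dispatchCost (G.netLoad ω.1 ω.2 (σ ω.1 ω.2)) * m₁ ω ∂x.prod G.load =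
      2 / (K * G.Δ) * (∫ ω, G.price σ ω.1 ω.2 * (σ ω.1 ω.2 - G.Smin) ∂x.prod G.load
        - ∫ ω, G.price σ ω.1 ω.2 * (ω.1 - G.Smin) ∂x.prod G.load) := by
    rw [← integral_sub i₂ i₁, ← integral_const_mul]
    refine integral_congr_ae (.of_forall fun ω => ?_)
    simp only [hm₁, price]; ring
  have d₂ : ∫ ω, deriv G.dispatchCost (G.netLoad ω.1 ω.2 (σ ω.1 ω.2)) * m₂ ω ∂x.prod G.load =
      2 / (K * G.Δ) * ∫ ω, G.price σ ω.1 ω.2 * (ω.1 - G.Smin) ∂x.prod G.load := by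
    rw [← integral_const_mul]
    refine integral_congr_ae (.of_forall fun ω => ?_)
    simp only [hm₂, price]; ring
  have hrev := hx.integral_price_mul hG hV hK.le hσ hP
  rw [d₁, d₂] at R
  -- `q` and `p` stand for the mean of price times closing and opening charge above `Smin`; they
  -- enter the derivative only through `q - δ p`.
  have er : ∀ p q E : ℝ, q - G.δ * p = -K * E → 1 / 2 * ((1 - G.δ)⁻¹ * (2 / (K * G.Δ) * (q - p))
      + 2 / (K * G.Δ) * p) = -(E / (G.Δ * (1 - G.δ))) := by
    intro p q E h
    rw [show q = G.δ * p + -K * E by linarith]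
    field_simp
    ring
  rw [er _ _ _ hrev] at R
  have hconv := hx.convexOn_integral_value hG hV
  -- This keeps the volumes `K + 2h`, `K + h` and `K - h` nonnegative.
  have hpos : ∀ᶠ h in 𝓝 (0 : ℝ), |h| < K / 2 := by
    have := (continuous_abs.tendsto (0 : ℝ))
    rw [abs_zero] at this
    exact this.eventually_lt_const (by linarith)
  refine hasDerivAt_of_le_of_midpoint R ?_ ?_ ?_
  · simp only [zero_mul, add_zero]
    rw [← hD, ← eD]
    have : ∫ ω, G.dispatchCost (G.netLoad ω.1 ω.2 (σ ω.1 ω.2)) ∂x.prod G.load = (1 - G.δ) * D := by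
      linarith
    rw [this]; field_simp; ring
  · filter_upwards [hpos] with h hh
    have hh' := abs_lt.1 hh
    have h2 : 0 ≤ K + 2 * h := by linarith
    have c : ∀ k : ℝ, Continuous fun S : ℝ => S + k / K * (S - G.Smin) := fun k => by fun_prop
    have u₁ := hx.integral_value_le hG hV hσ h2 (c (2 * h)) (c (2 * h))
      (fun s hs => scale_mem_charges hK h2 hs)
    -- For `h < 0` these opening states may exceed `Smin + K`; this is harmless since only closing
    -- states are constrained.
    have u₂ := hx.integral_value_le hG hV hσ hK.le (c (-(2 * h))) continuous_id (fun s hs => hs)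
    have n₁ : ∀ ω : ℝ × ℝ, G.netLoad (ω.1 + 2 * h / K * (ω.1 - G.Smin)) ω.2
        (σ ω.1 ω.2 + 2 * h / K * (σ ω.1 ω.2 - G.Smin))
        = G.netLoad ω.1 ω.2 (σ ω.1 ω.2) + h * m₁ ω := by
      intro ω; simp only [netLoad, hm₁]; field_simp; ring
    have n₂ : ∀ ω : ℝ × ℝ, G.netLoad (ω.1 + -(2 * h) / K * (ω.1 - G.Smin)) ω.2
        (id (σ ω.1 ω.2)) = G.netLoad ω.1 ω.2 (σ ω.1 ω.2) + h * m₂ ω := by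
      intro ω; simp only [netLoad, hm₂, id]; field_simp; ring
    simp only [n₁] at u₁
    simp only [n₂] at u₂
    simp only [id] at u₂
    have j₁ := (hx.memLp_value hG hV h2 (c (2 * h))).integrable le_top
    have j₂ := (hx.memLp_value hG hV hK.le (c (-(2 * h)))).integrable le_top
    -- The dilation and the contraction cancel at the midpoint, which leaves `S`, and hence `x`,
    -- unchanged.
    have hmid : ∫ S, V (K + h) S ∂x ≤ 1 / 2 * (∫ S, V (K + 2 * h) (S + 2 * h / K * (S - G.Smin)) ∂x
        + ∫ S, V K (S + -(2 * h) / K * (S - G.Smin)) ∂x) := by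
      rw [← integral_add j₁ j₂, ← integral_const_mul]
      refine integral_mono ((hx.memLp_value hG hV (by linarith) continuous_id).integrable le_top)
        ((j₁.add j₂).const_mul _) fun S => ?_
      have := hV.mix_le hG h2 hK.le (a := 1 / 2) (b := 1 / 2) (by norm_num) (by norm_num)
        (by norm_num) (S + 2 * h / K * (S - G.Smin)) (S + -(2 * h) / K * (S - G.Smin))
      rw [show 1 / 2 * (K + 2 * h) + 1 / 2 * K = K + h by ring,
        show 1 / 2 * (S + 2 * h / K * (S - G.Smin)) + 1 / 2 * (S + -(2 * h) / K * (S - G.Smin)) = S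
          by ring] at this
      linarith
    refine hmid.trans (mul_le_mul_of_nonneg_left (add_le_add ?_ u₂) (by norm_num))
    -- In `u₁` the same average value stands on both sides, with weight `δ` on the right; solving
    -- for it gives the factor `(1 - δ)⁻¹`.
    rw [← mul_le_mul_iff_right₀ hδ, mul_inv_cancel_left₀ hδ.ne']
    linarith
  · filter_upwards [hpos] with h hh
    have hh' := abs_lt.1 hh
    have := hconv.2 (show K + h ∈ Ici 0 by simp only [mem_Ici]; linarith)
      (show K - h ∈ Ici 0 by simp only [mem_Ici]; linarith)
      (by norm_num : (0 : ℝ) ≤ 1 / 2) (by norm_num : (0 : ℝ) ≤ 1 / 2) (by norm_num)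
    simp only [smul_eq_mul] at this
    rw [show 1 / 2 * (K + h) + 1 / 2 * (K - h) = K by ring] at this
    linarith

/-- Average total cost is convex on `[0, ∞)` up to a constant, and `K > 0` is interior, so
minimality amounts to a zero derivative; the factor `1 - δ` cancels. -/
theorem IsStationary.isOptimalVolume_iff (hG : G.Servable) (hV : G.IsValueFunction V)
    (hx : G.IsStationary K σ x) (hK : 0 < K) (hσ : G.IsOptimalPolicy V K σ)
    (hP : G.HasPrices K σ) : G.IsOptimalVolume V x K ↔ G.meanExcess σ x = G.Δ * G.fS := by
  have := hx.1
  have hΔ := G.Δ_pos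
  have hδ : 0 < 1 - G.δ := sub_pos.2 G.δ_lt_one
  set T : ℝ → ℝ := fun K' => ∫ S, V K' S ∂x + G.fS / (1 - G.δ) * K' with hT
  have hcost : ∀ K', 0 ≤ K' → ∫ S, G.totalCost V K' S ∂x = T K' + G.genFixedCost / (1 - G.δ) := by
    intro K' hK'
    have i := (hx.memLp_value hG hV hK' continuous_id).integrable le_top
    simp only [id] at i
    simp only [totalCost, hT]
    rw [integral_add (i.fun_add (integrable_const _)) (integrable_const _),
      integral_add i (integrable_const _)]
    simp only [integral_const, probReal_univ, one_smul]
    ring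
  have hopt : G.IsOptimalVolume V x K ↔ IsMinOn T (Ici 0) K := by
    refine forall_congr' fun K' => forall_congr' fun hK' => ?_
    rw [hcost K hK.le, hcost K' hK', add_le_add_iff_right]
    rfl
  have hder : HasDerivAt T (-(G.meanExcess σ x / (G.Δ * (1 - G.δ))) + G.fS / (1 - G.δ)) K := by
    simpa using (hx.hasDerivAt_integral_value hG hV hK hσ hP).fun_add
      ((hasDerivAt_id K).const_mul (G.fS / (1 - G.δ)))
  have hconv : ConvexOn ℝ (Ici 0) T := by
    refine (hx.convexOn_integral_value hG hV).add ?_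
    exact ((LinearMap.mul ℝ ℝ (G.fS / (1 - G.δ))).convexOn (convex_Ici 0))
  have hzero : -(G.meanExcess σ x / (G.Δ * (1 - G.δ))) + G.fS / (1 - G.δ) = 0 ↔
      G.meanExcess σ x = G.Δ * G.fS := by
    field_simp
    constructor <;> intro h <;> linarith
  rw [hopt, ← hzero]
  constructor
  · intro h
    exact (h.isLocalMin (Ici_mem_nhds hK)).hasDerivAt_eq_zero hder
  · intro h
    refine hconv.isMinOn_of_rightDeriv_eq_zero (by simpa using hK) ?_
    rw [hder.hasDerivWithinAt.derivWithin (uniqueDiffWithinAt_Ioi K), h]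

end PowerSystem

/-! ### Duration curves and the area formula -/

namespace PowerSystem

variable {ι : Type*} [Fintype ι] {G : PowerSystem ι} {V : ℝ → ℝ → ℝ} {K : ℝ} {σ : ℝ → ℝ → ℝ}
  {x : Measure ℝ}

/-- The load-duration curve is the generalized inverse of the survival function of the load. -/
theorem le_loadOfDuration_iff {d : ℝ} (hd : d ∈ Ioo (0 : ℝ) 1) (l : ℝ) :
    l ≤ G.loadOfDuration d ↔ d ≤ G.load.real (Ici l) := by
  set A := {l | d ≤ G.load.real (Ici l)} with hA
  have hne : A.Nonempty := by
    refine ⟨G.Lmin, ?_⟩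
    have : G.load.real (Ici G.Lmin) = 1 := by
      have h : G.load (Ici G.Lmin) = 1 := by
        rw [← mem_ae_iff_prob_eq_one measurableSet_Ici]
        filter_upwards [G.load_mem] with y hy using hy.1
      rw [Measure.real, h, toReal_one]
    simp only [hA, mem_ofPred_eq, this]; exact hd.2.le
  have hbdd : BddAbove A := by
    refine ⟨G.Lmax, fun l hl => ?_⟩
    by_contra! h
    have h0 : G.load (Ici l) = 0 := by
      rw [← compl_mem_ae_iff]
      filter_upwards [G.load_mem] with y hy
      simp only [mem_compl_iff, mem_Ici, not_le]
      exact hy.2.trans_lt h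
    have hl' : d ≤ G.load.real (Ici l) := hl
    simp only [Measure.real, h0, toReal_zero] at hl'
    linarith [hd.1]
  have hlow : ∀ {l l'}, l' ≤ l → l ∈ A → l' ∈ A := fun h hl =>
    le_trans (b := G.load.real (Ici _)) hl (measureReal_mono (Ici_subset_Ici.2 h))
  -- The supremum is attained: the survival function is left continuous, by continuity of the
  -- measure along decreasing half-lines.
  have hmem : G.loadOfDuration d ∈ A := by
    obtain ⟨u, hu, hlt, hlim⟩ := exists_seq_strictMono_tendsto (G.loadOfDuration d)
    have hInter : ⋂ k, Ici (u k) = Ici (G.loadOfDuration d) := by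
      ext y
      simp only [mem_iInter, mem_Ici]
      exact ⟨fun h => le_of_tendsto' hlim h, fun h k => (hlt k).le.trans h⟩
    have ht := tendsto_measure_iInter_atTop (μ := G.load) (s := fun k => Ici (u k))
      (fun k => measurableSet_Ici.nullMeasurableSet)
      (fun i j hij => Ici_subset_Ici.2 (hu.monotone hij)) ⟨0, measure_ne_top _ _⟩
    rw [hInter] at ht
    refine (ENNReal.ofReal_le_iff_le_toReal (measure_ne_top _ _)).1 (ge_of_tendsto' ht fun k => ?_)
    obtain ⟨l, hl, hkl⟩ := exists_lt_of_lt_csSup hne (hlt k)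
    exact (ENNReal.ofReal_le_iff_le_toReal (measure_ne_top _ _)).2 (hlow hkl.le hl)
  exact ⟨fun h => hlow h hmem, fun h => le_csSup hbdd h⟩

/-- The load-duration curve, cut off outside of the durations `(0, 1)`. -/
noncomputable def durationCurve (G : PowerSystem ι) : ℝ → ℝ :=
  (Ioo (0 : ℝ) 1).indicator G.loadOfDuration

theorem preimage_durationCurve (l : ℝ) :
    G.durationCurve ⁻¹' Ici l ∩ Ioo 0 1 = Iic (G.load.real (Ici l)) ∩ Ioo 0 1 := by
  ext d
  refine and_congr_left fun hd => ?_
  simp only [mem_preimage, durationCurve, indicator_of_mem hd, mem_Ici, mem_Iic]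
  exact le_loadOfDuration_iff hd l

theorem measurable_durationCurve : Measurable G.durationCurve := by
  refine measurable_of_Ici fun l => ?_
  rw [← inter_union_compl (G.durationCurve ⁻¹' Ici l) (Ioo 0 1), preimage_durationCurve]
  refine (measurableSet_Iic.inter measurableSet_Ioo).union ?_
  have : G.durationCurve ⁻¹' Ici l ∩ (Ioo 0 1)ᶜ = {d | l ≤ 0} ∩ (Ioo 0 1)ᶜ := by
    ext d
    refine and_congr_left fun hd => ?_
    simp [durationCurve, indicator_of_notMem hd]
  rw [this]
  exact (MeasurableSet.const _).inter measurableSet_Ioo.compl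

/-- The load of a uniformly distributed duration is distributed as the load. -/
theorem map_durationCurve :
    (volume.restrict (Ioo (0 : ℝ) 1)).map G.durationCurve = G.load := by
  have : IsFiniteMeasure (volume.restrict (Ioo (0 : ℝ) 1)) := ⟨by simp⟩
  refine Measure.ext_of_Ici _ _ fun l => ?_
  rw [Measure.map_apply measurable_durationCurve measurableSet_Ici,
    Measure.restrict_apply' measurableSet_Ioo, preimage_durationCurve,
    ← ENNReal.ofReal_toReal (measure_ne_top G.load (Ici l))]
  change _ = ENNReal.ofReal (G.load.real (Ici l))
  set m := G.load.real (Ici l)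
  have hm : m ≤ 1 := measureReal_le_one
  -- The set differs from `(0, m)` at most in the point `m`, which is excluded when `m = 1`.
  refine le_antisymm ?_ ?_
  · calc volume (Iic m ∩ Ioo 0 1) ≤ volume (Ioc 0 m) :=
          measure_mono fun d hd => ⟨hd.2.1, hd.1⟩
      _ = ENNReal.ofReal m := by simp
  · calc ENNReal.ofReal m = volume (Ioo 0 m) := by simp
      _ ≤ volume (Iic m ∩ Ioo 0 1) :=
          measure_mono fun d hd => ⟨hd.2.le, hd.1, hd.2.trans_le hm⟩

/-- The area between two curves drawn against the duration of the load. -/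
theorem volume_between_duration {f g : ℝ → ℝ} (hf : Measurable f) (hg : Measurable g) :
    (volume : Measure (ℝ × ℝ)).real {z | z.1 ∈ Ioo 0 1 ∧ f (G.loadOfDuration z.1) ≤ z.2 ∧
      z.2 ≤ g (G.loadOfDuration z.1)} = ∫ l, max (g l - f l) 0 ∂G.load := by
  have hset : {z : ℝ × ℝ | z.1 ∈ Ioo 0 1 ∧ f (G.loadOfDuration z.1) ≤ z.2 ∧
      z.2 ≤ g (G.loadOfDuration z.1)} = {z : ℝ × ℝ | z.1 ∈ Ioo 0 1 ∧
        f (G.durationCurve z.1) ≤ z.2 ∧ z.2 ≤ g (G.durationCurve z.1)} := by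
    ext z
    refine and_congr_right fun hz => ?_
    rw [durationCurve, indicator_of_mem hz]
  have mq : Measurable fun z : ℝ × ℝ => G.durationCurve z.1 :=
    measurable_durationCurve.comp measurable_fst
  have hmeas : MeasurableSet {z : ℝ × ℝ | z.1 ∈ Ioo 0 1 ∧
      f (G.durationCurve z.1) ≤ z.2 ∧ z.2 ≤ g (G.durationCurve z.1)} :=
    (measurable_fst measurableSet_Ioo).inter
      ((measurableSet_le (hf.comp mq) measurable_snd).inter
        (measurableSet_le measurable_snd (hg.comp mq)))
  have hmax : Measurable fun l => max (g l - f l) 0 := (hg.sub hf).max measurable_const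
  have hint : ∫ l, max (g l - f l) 0 ∂G.load =
      (∫⁻ l, ENNReal.ofReal (max (g l - f l) 0) ∂G.load).toReal :=
    integral_eq_lintegral_of_nonneg_ae (.of_forall fun l => le_max_right _ _)
      hmax.aestronglyMeasurable
  rw [hset, hint, Measure.real, Measure.volume_eq_prod, Measure.prod_apply hmeas]
  congr 1
  have hm : Measurable fun l => ENNReal.ofReal (max (g l - f l) 0) :=
    hmax.ennreal_ofReal
  rw [← map_durationCurve (G := G), lintegral_map hm measurable_durationCurve,
    ← lintegral_indicator measurableSet_Ioo]
  refine lintegral_congr fun d => ?_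
  -- By Fubini only the vertical sections matter. A section is empty when the curves cross the other
  -- way, where `ENNReal.ofReal` of the negative difference is zero, as is the maximum.
  by_cases hd : d ∈ Ioo (0 : ℝ) 1
  · have : Prod.mk d ⁻¹' {z : ℝ × ℝ | z.1 ∈ Ioo 0 1 ∧ f (G.durationCurve z.1) ≤ z.2 ∧
        z.2 ≤ g (G.durationCurve z.1)} = Icc (f (G.durationCurve d)) (g (G.durationCurve d)) := by
      ext y
      simp only [mem_preimage, mem_ofPred_eq, mem_Icc, hd, true_and]
    rw [this, Real.volume_Icc, indicator_of_mem hd, ENNReal.ofReal_max]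
    simp
  · have : Prod.mk d ⁻¹' {z : ℝ × ℝ | z.1 ∈ Ioo 0 1 ∧ f (G.durationCurve z.1) ≤ z.2 ∧
        z.2 ≤ g (G.durationCurve z.1)} = ∅ := by
      ext y
      simp only [mem_preimage, mem_ofPred_eq, hd, false_and, mem_empty_iff_false]
    rw [this, measure_empty, indicator_of_notMem hd]

theorem area_eq (hσ : Measurable (Function.uncurry σ)) (S : ℝ) :
    G.area σ S = ∫ l, G.excess σ S l ∂G.load := by
  simp only [excess_eq_max]
  exact volume_between_duration ((measurable_price hσ).comp measurable_prodMk_left)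
    (((measurable_nextPrice hσ).comp measurable_prodMk_left).const_mul G.δ)

end PowerSystem

theorem theorem2 {ι : Type*} [Fintype ι] (G : PowerSystem ι) (hG : G.Servable)
    (V : ℝ → ℝ → ℝ) (hV : G.IsValueFunction V)
    (K : ℝ) (hK : 0 < K)
    (σ : ℝ → ℝ → ℝ) (hσ : G.IsOptimalPolicy V K σ) (hP : G.HasPrices K σ)
    (x : MeasureTheory.Measure ℝ) (hx : G.IsStationary K σ x) :
    (G.IsOptimalVolume V x K ↔ ∫ S, G.area σ S ∂x = G.Δ * G.fS) ∧
      (G.IsOptimalVolume V x K ↔ G.meanExcess σ x = G.Δ * G.fS) := by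
  have h := hx.isOptimalVolume_iff hG hV hK hσ hP
  refine ⟨?_, h⟩
  simp only [PowerSystem.area_eq hσ.1]
  exact h
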